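/- For integers $n\ge 3$ and $k\ge 0$, the crown $S_n^k$ is the poset with ground set $\{a_1,\dots,a_{n+k}\}\cup\{b_1,\dots,b_{n+k}\}$, indices read cyclically modulo $n+k$, whose only strict relations are $a_i<b_j$ for $j\notin\{i,i+1,\dots,i+k\}$. In a poset $P$, a critical pair is an ordered pair $(x,y)$ of incomparable elements such that $z<x$ implies $z<y$, and $w>y$ implies $w>x$. A set $R$ of critical pairs is reversible if there is a linear extension $L$ of $P$ with $x>y$ in $L$ for all $(x,y)\in R$. The graph of critical pairs of $P$ has the critical pairs as vertices, and two distinct critical pairs $p,q$ are adjacent when $\{p,q\}$ is not reversible but each of its proper subsets is. Let $G_n^k$ be the graph of critical pairs of $S_n^k$. Theorem. Let $n,k$ be integers with $3\le n\le k$. If $S$ is an independent set in $G_n^k$ that is not reversible, then \[|S|\le \frac{(k+1)(k+2)}{2}+2-n .\] Moreover, for every such $n,k$ this bound is attained: there is an independent, non-reversible set $S$ in $G_n^k$ with $|S|=\frac{(k+1)(k+2)}{2}+2-n$. -/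

import Mathlib

section GeneralPosets

variable (P : Type*) [PartialOrder P]

/-- The critical pairs of a poset: incomparable pairs `(x, y)` such that `z < x` implies `z < y`
and `y < w` implies `x < w`. -/
def Crit : Set (P × P) :=
  {p | IncompRel (· ≤ ·) p.1 p.2 ∧ (∀ z, z < p.1 → z < p.2) ∧ (∀ w, p.2 < w → p.1 < w)}

variable {P}

/-- A set `R` of pairs is reversible when some linear extension `L` of `P` has `x > y` in `L` for
all `(x, y) ∈ R`. -/
def Reversible (R : Set (P × P)) : Prop :=
  ∃ L : P → P → Prop, IsLinearOrder P L ∧ (∀ x y, x ≤ y → L x y) ∧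
    ∀ p ∈ R, L p.2 p.1 ∧ p.2 ≠ p.1

/-- A set of critical pairs is reversible when its underlying set of pairs is. -/
def CritReversible (S : Set (Crit P)) : Prop :=
  Reversible (Subtype.val '' S)

/-- The edges of the hypergraph of critical pairs: the sets of critical pairs that are not
reversible although every proper subset is. -/
def IsCritHyperedge (E : Set (Crit P)) : Prop :=
  ¬ CritReversible E ∧ ∀ F : Set (Crit P), F ⊂ E → CritReversible F

variable (P)

/-- The graph of critical pairs: its edges are the edges of size two of the hypergraph of
critical pairs. -/
def critGraph : SimpleGraph (Crit P) where
  Adj p q := p ≠ q ∧ IsCritHyperedge {p, q}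
  symm := ⟨fun p q h => ⟨h.1.symm, by rw [Set.pair_comm]; exact h.2⟩⟩
  loopless := ⟨fun _ h => h.1 rfl⟩

end GeneralPosets

/-- The ground set of the crown `S_n^k`: minimal elements `a i` and maximal elements `b j`, with
indices read cyclically modulo `n + k`. -/
inductive Crown (n k : ℕ) : Type
  | a (i : ZMod (n + k)) : Crown n k
  | b (j : ZMod (n + k)) : Crown n k

namespace Crown

/-- The order of the crown `S_n^k`: `a i < b j` exactly when `j` is not in the cyclic interval
`{i, i + 1, …, i + k}`, and there are no other strict relations. -/
inductive Le (n k : ℕ) : Crown n k → Crown n k → Prop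
  | refl (x : Crown n k) : Le n k x x
  | ab (i j : ZMod (n + k)) (h : ∀ t : ℕ, t ≤ k → j ≠ i + (t : ZMod (n + k))) :
      Le n k (a i) (b j)

instance (n k : ℕ) : PartialOrder (Crown n k) where
  le := Le n k
  le_refl := Le.refl
  le_trans x y z h₁ h₂ := by
    cases h₁ with
    | refl => exact h₂
    | ab i j h => cases h₂ with
      | refl => exact Le.ab i j h
  le_antisymm x y h₁ h₂ := by
    cases h₁ with
    | refl => rfl
    | ab i j h => cases h₂

end Crown

/-! Every critical pair is an `(a i, b j)` with `a i` not below `b j`, so a set of them is a family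
of rows: row `i` collects the `j`. Write x → i if `a x < b j` for some `j` in row `i`; reversing the
pairs then puts `a x` below `a i`. Acyclicity of → gives reversibility, and independence makes →
asymmetric (`reversible_of_acyclic`, `rowRel_asymm_of_isIndepSet`).

Let Q i be the set of x with x ↛ i, A the set of nonempty rows, s = |A|, m = k + 2 - s. Since Q i
misses the arcs {j + 1, …, j + n - 1}, j in row i, Cauchy–Davenport gives |row i| + |Q i| ≤ k + 2.
Asymmetry gives 2 ∑ |Q i ∩ A| ≥ s(s + 1). Summing over A, 2|S| ≤ (k + 1)(k + 2) - m(m - 1) - 2 ∑ |Q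
i \ A|.

The missing 2(n - 2) comes from non-reversibility (`two_mul_card_le_of_cycle`). Either some row
bound improves by n - 2, as it does when Q i is not an arc, or a shortest cycle of → yields three
sets Q i covering the circle. Then ∑ |Q i \ A| ≥ n + k - s = m + n - 2, which suffices because m(m +
1) ≥ 0. -/

section Relations

/-! ### Cycles in relations -/

/-- An asymmetric relation with a directed cycle contains a directed path on three edges with no
forward chord. -/
theorem exists_chordless_path {α : Type*} {R : α → α → Prop} (hR : ∀ x y, R x y → ¬ R y x)
    (hcyc : ∃ x, Relation.TransGen R x x) :
    ∃ u v w x, R u v ∧ R v w ∧ R w x ∧ ¬ R u w ∧ ¬ R v x ∧ ¬ R u x := by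
  classical
  let walk : ℕ → α → α → Prop := fun l => Nat.rec (fun x y => x = y)
    (fun _ W x y => ∃ z, R x z ∧ W z y) l
  have walk_zero : ∀ x y, walk 0 x y ↔ x = y := fun _ _ => Iff.rfl
  have walk_succ : ∀ l x y, walk (l + 1) x y ↔ ∃ z, R x z ∧ walk l z y := fun _ _ _ => Iff.rfl
  clear_value walk
  have hex : ∃ l, 0 < l ∧ ∃ x, walk l x x := by
    obtain ⟨x, hx⟩ := hcyc
    have key : ∀ y, Relation.TransGen R y x → ∃ l, 0 < l ∧ walk l y x := by
      intro y hy
      induction hy using Relation.TransGen.head_induction_on with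
      | single h => exact ⟨1, one_pos, (walk_succ _ _ _).2 ⟨x, h, (walk_zero _ _).2 rfl⟩⟩
      | head h _ ih =>
        obtain ⟨l, _, hl⟩ := ih
        exact ⟨l + 1, l.succ_pos, (walk_succ _ _ _).2 ⟨_, h, hl⟩⟩
    obtain ⟨l, hl, h⟩ := key x hx
    exact ⟨l, hl, x, h⟩
  obtain ⟨hpos, u, hu⟩ := Nat.find_spec hex
  have hmin : ∀ l, 0 < l → l < Nat.find hex → ∀ x, ¬ walk l x x :=
    fun l h0 hl x hx => Nat.find_min hex hl ⟨h0, x, hx⟩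
  generalize Nat.find hex = l at hpos hu hmin
  match l, hpos, hu, hmin with
  | 1, _, hu, _ =>
    obtain ⟨v, huv, hv⟩ := (walk_succ _ _ _).1 hu
    rw [walk_zero] at hv
    subst hv
    exact absurd huv (hR _ _ huv)
  | 2, _, hu, _ =>
    obtain ⟨v, huv, hv⟩ := (walk_succ _ _ _).1 hu
    obtain ⟨w, hvw, hw⟩ := (walk_succ _ _ _).1 hv
    rw [walk_zero] at hw
    subst hw
    exact absurd huv (hR _ _ hvw)
  | l + 3, _, hu, hmin =>
    obtain ⟨v, huv, hv⟩ := (walk_succ _ _ _).1 hu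
    obtain ⟨w, hvw, hw⟩ := (walk_succ _ _ _).1 hv
    obtain ⟨x, hwx, hx⟩ := (walk_succ _ _ _).1 hw
    -- Four consecutive vertices of a shortest closed walk, where `x = u` if its length is 3; any
    -- forward chord would shorten it.
    refine ⟨u, v, w, x, huv, hvw, hwx, fun h => ?_, fun h => ?_, fun h => ?_⟩
    · exact hmin (l + 2) (by omega) (by omega) u
        ((walk_succ _ _ _).2 ⟨w, h, (walk_succ _ _ _).2 ⟨x, hwx, hx⟩⟩)
    · exact hmin (l + 2) (by omega) (by omega) u
        ((walk_succ _ _ _).2 ⟨v, huv, (walk_succ _ _ _).2 ⟨x, h, hx⟩⟩)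
    · exact hmin (l + 1) (by omega) (by omega) u ((walk_succ _ _ _).2 ⟨x, h, hx⟩)

/-- A relation without directed cycles extends to a linear order. -/
theorem exists_isLinearOrder_of_acyclic {α : Type*} {E : α → α → Prop}
    (hE : ∀ x, ¬ Relation.TransGen E x x) :
    ∃ L : α → α → Prop, IsLinearOrder α L ∧ ∀ x y, E x y → L x y := by
  have : IsPartialOrder α (Relation.ReflTransGen E) :=
    { refl := fun _ => Relation.ReflTransGen.refl
      trans := fun _ _ _ => Relation.ReflTransGen.trans
      antisymm := fun x y hxy hyx => by
        rcases Relation.reflTransGen_iff_eq_or_transGen.1 hxy with h | h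
        · exact h.symm
        · exact absurd (h.trans_left hyx) (hE x) }
  obtain ⟨L, hL, hle⟩ := extend_partialOrder (Relation.ReflTransGen E)
  exact ⟨L, hL, fun x y h => hle x y (Relation.ReflTransGen.single h)⟩

end Relations

/-! ### The crown order and its critical pairs -/

namespace Crown

variable {n k : ℕ}

theorem a_lt_b_iff_forall {i j : ZMod (n + k)} :
    (a i : Crown n k) < b j ↔ ∀ t : ℕ, t ≤ k → j ≠ i + (t : ZMod (n + k)) := by
  constructor
  · intro h
    cases (show Le n k (a i) (b j) from h.le) with
    | ab _ _ h => exact h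
  · intro h
    exact lt_of_le_of_ne (Le.ab i j h) (by simp)

theorem not_lt_a (x : Crown n k) (i : ZMod (n + k)) : ¬ x < a i := by
  intro h
  cases (show Le n k x (a i) from h.le) with
  | refl => exact lt_irrefl _ h

theorem not_b_lt (x : Crown n k) (j : ZMod (n + k)) : ¬ b j < x := by
  intro h
  cases (show Le n k (b j) x from h.le) with
  | refl => exact lt_irrefl _ h

theorem a_lt_b_iff_val [NeZero (n + k)] {i j : ZMod (n + k)} :
    (a i : Crown n k) < b j ↔ (j.val < i.val ∧ i.val < j.val + n) ∨ i.val + k < j.val := by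
  rw [a_lt_b_iff_forall]
  have hi := i.val_lt
  have hj := j.val_lt
  constructor
  · intro h
    by_contra hc
    rcases le_or_gt i.val j.val with hij | hij
    · refine h (j.val - i.val) (by omega) ?_
      rw [Nat.cast_sub hij]
      simp
    · refine h (j.val + (n + k) - i.val) (by omega) ?_
      rw [Nat.cast_sub (by omega), Nat.cast_add, ZMod.natCast_self]
      simp
  · rintro h t ht rfl
    rw [ZMod.val_add, ZMod.val_natCast, Nat.add_mod_mod] at h
    rcases lt_or_ge (i.val + t) (n + k) with hlt | hge
    · rw [Nat.mod_eq_of_lt hlt] at h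
      omega
    · rw [Nat.mod_eq_sub_mod hge, Nat.mod_eq_of_lt (by omega)] at h
      omega

/-- The elements below `b j` are the `a x` with `x` in the cyclic interval
`{j + 1, …, j + (n - 1)}`. -/
theorem a_lt_b_iff_exists [NeZero (n + k)] {x j : ZMod (n + k)} :
    (a x : Crown n k) < b j ↔ ∃ t : ℕ, 1 ≤ t ∧ t < n ∧ x = j + (t : ZMod (n + k)) := by
  have hx := x.val_lt
  have hj := j.val_lt
  rw [a_lt_b_iff_val]
  constructor
  · rintro (h | h)
    · refine ⟨x.val - j.val, by omega, by omega, ?_⟩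
      rw [Nat.cast_sub h.1.le]
      simp
    · refine ⟨x.val + (n + k) - j.val, by omega, by omega, ?_⟩
      rw [Nat.cast_sub (by omega), Nat.cast_add, ZMod.natCast_self]
      simp
  · rintro ⟨t, ht, htn, rfl⟩
    rw [ZMod.val_add, ZMod.val_natCast, Nat.add_mod_mod]
    rcases lt_or_ge (j.val + t) (n + k) with hlt | hge
    · rw [Nat.mod_eq_of_lt hlt]
      omega
    · rw [Nat.mod_eq_sub_mod hge, Nat.mod_eq_of_lt (by omega)]
      omega

theorem mem_crit_of_not_lt {i j : ZMod (n + k)} (h : ¬ (a i : Crown n k) < b j) :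
    ((a i, b j) : Crown n k × Crown n k) ∈ Crit (Crown n k) := by
  refine ⟨⟨fun hle => h (lt_of_le_of_ne hle (by simp)), fun hle => ?_⟩,
    fun z hz => absurd hz (not_lt_a _ _), fun w hw => absurd hw (not_b_lt _ _)⟩
  exact not_b_lt _ _ (lt_of_le_of_ne hle (by simp))

/-- Distinct `a`'s have distinct arcs of `n - 1` upper bounds, so neither arc contains the other;
dually for the `b`'s. A pair `(b i, a j)` fails because something lies below `b i` and nothing below
`a j`. -/
theorem exists_eq_of_mem_crit (hn : 3 ≤ n) (hnk : n ≤ k) {p : Crown n k × Crown n k}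
    (hp : p ∈ Crit (Crown n k)) : ∃ i j, p = (a i, b j) ∧ ¬ (a i : Crown n k) < b j := by
  have : NeZero (n + k) := ⟨by omega⟩
  have hval : ∀ w, w < n + k → ((w : ZMod (n + k))).val = w := fun w hw => ZMod.val_cast_of_lt hw
  obtain ⟨x, y⟩ := p
  obtain ⟨⟨h₁, h₂⟩, hdown, hup⟩ := hp
  have hne : x ≠ y := fun h => h₁ h.le
  cases x with
  | a i =>
    cases y with
    | b j => exact ⟨i, j, rfl, fun h => h₁ h.le⟩
    | a j =>
      exfalso
      have hij : i.val ≠ j.val := fun h => hne (congrArg a (ZMod.val_injective _ h))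
      have hi := i.val_lt
      have hj := j.val_lt
      have key : ∀ w, w < n + k → ((w < j.val ∧ j.val < w + n) ∨ j.val + k < w) →
          ((w < i.val ∧ i.val < w + n) ∨ i.val + k < w) := by
        intro w hw h
        have := hup (b (w : ZMod (n + k)))
        simp only [a_lt_b_iff_val, hval w hw] at this
        exact this h
      -- The two ends `j - 1` and `j - (n - 1)` of the arc of upper bounds of `a j`. The other arc
      -- can hold both only if the arcs coincide, since `n ≤ k` stops it from going the other way
      -- round.
      have h1 := key (if j.val = 0 then n + k - 1 else j.val - 1) (by split <;> omega)
        (by split <;> omega)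
      have h2 := key (if n - 1 ≤ j.val then j.val - (n - 1) else j.val + k + 1)
        (by split <;> omega) (by split <;> omega)
      split at h1 <;> split at h2 <;> omega
  | b i =>
    exfalso
    have hi := i.val_lt
    cases y with
    | a j =>
      have h := hdown (a ((if i.val = n + k - 1 then 0 else i.val + 1 : ℕ) : ZMod (n + k)))
        (by
          rw [a_lt_b_iff_val, hval _ (by split <;> omega)]
          split <;> omega)
      exact not_lt_a _ _ h
    | b j =>
      have hij : i.val ≠ j.val := fun h => hne (congrArg b (ZMod.val_injective _ h))
      have hj := j.val_lt
      have key : ∀ w, w < n + k → ((i.val < w ∧ w < i.val + n) ∨ w + k < i.val) →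
          ((j.val < w ∧ w < j.val + n) ∨ w + k < j.val) := by
        intro w hw h
        have := hdown (a (w : ZMod (n + k)))
        simp only [a_lt_b_iff_val, hval w hw] at this
        exact this h
      have h1 := key (if i.val = n + k - 1 then 0 else i.val + 1) (by split <;> omega)
        (by split <;> omega)
      have h2 := key (if i.val + (n - 1) < n + k then i.val + (n - 1) else i.val - (k + 1))
        (by split <;> omega) (by split <;> omega)
      split at h1 <;> split at h2 <;> omega

/-! ### Reversibility through the row relation -/

/-- The relation `a x < b j` for some pair `(a i, b j)` of `R`, as a relation between `x`
and `i`. -/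
def RowRel (R : Set (Crown n k × Crown n k)) (x i : ZMod (n + k)) : Prop :=
  ∃ j, (a i, b j) ∈ R ∧ (a x : Crown n k) < b j

/-- Add the reversed pairs to the order. Paths alternate between `a`'s and `b`'s, and two steps from
`a` to `a` make one step of `RowRel`, so a cycle would project to a cycle of `RowRel`. -/
theorem reversible_of_acyclic {R : Set (Crown n k × Crown n k)}
    (hR : ∀ p ∈ R, ∃ i j, p = (a i, b j)) (hcyc : ∀ x, ¬ Relation.TransGen (RowRel R) x x) :
    Reversible R := by
  let E : Crown n k → Crown n k → Prop := fun x y => x < y ∨ (y, x) ∈ R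
  have hEab : ∀ i y, E (a i) y → ∃ j, y = b j ∧ (a i : Crown n k) < b j := by
    rintro i y (h | h)
    · cases y with
      | a i' => exact absurd h (not_lt_a _ _)
      | b j => exact ⟨j, rfl, h⟩
    · obtain ⟨i', j', h'⟩ := hR _ h
      simp at h'
  have hEba : ∀ j y, E (b j) y → ∃ i, y = a i ∧ (a i, b j) ∈ R := by
    rintro j y (h | h)
    · exact absurd h (not_b_lt _ _)
    · obtain ⟨i', j', h'⟩ := hR _ h
      simp only [Prod.mk.injEq] at h'
      obtain ⟨rfl, -⟩ := h'
      exact ⟨i', rfl, h⟩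
  have hpath : ∀ i y, Relation.TransGen E (a i) y →
      (∀ i', y = a i' → Relation.TransGen (RowRel R) i i') ∧
      (∀ j, y = b j → ∃ i', Relation.ReflTransGen (RowRel R) i i' ∧
        (a i' : Crown n k) < b j) := by
    intro i y h
    induction h with
    | single h =>
      obtain ⟨j, rfl, hj⟩ := hEab _ _ h
      refine ⟨fun _ h => by simp at h, fun j' h' => ?_⟩
      cases h'
      exact ⟨i, .refl, hj⟩
    | @tail y z _ h ih =>
      cases y with
      | a i' =>
        obtain ⟨j, rfl, hj⟩ := hEab _ _ h
        refine ⟨fun _ h => by simp at h, fun j' h' => ?_⟩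
        cases h'
        exact ⟨i', (ih.1 _ rfl).to_reflTransGen, hj⟩
      | b j =>
        obtain ⟨i'', rfl, hi⟩ := hEba _ _ h
        refine ⟨fun i₁ h₁ => ?_, fun _ h => by simp at h⟩
        cases h₁
        obtain ⟨i', hi', hlt⟩ := ih.2 _ rfl
        exact Relation.TransGen.tail' hi' ⟨j, hi, hlt⟩
  have hEa : ∀ i, ¬ Relation.TransGen E (a i) (a i) := fun i h =>
    hcyc i ((hpath i _ h).1 i rfl)
  have hE : ∀ x, ¬ Relation.TransGen E x x := by
    intro x h
    cases x with
    | a i => exact hEa i h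
    | b j =>
      obtain ⟨y, hy, hyb⟩ := Relation.TransGen.head'_iff.1 h
      obtain ⟨i, rfl, -⟩ := hEba _ _ hy
      exact hEa i (Relation.TransGen.tail' hyb hy)
  obtain ⟨L, hL, hle⟩ := exists_isLinearOrder_of_acyclic hE
  refine ⟨L, hL, fun x y hxy => ?_, fun p hp => ⟨hle _ _ (Or.inr hp), ?_⟩⟩
  · rcases hxy.eq_or_lt with rfl | h
    · exact hL.refl _
    · exact hle _ _ (Or.inl h)
  · obtain ⟨i, j, rfl⟩ := hR p hp
    simp

/-- A reversed pair `(a i, b j)` puts `a i` above everything below `b j`. -/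
theorem not_rel_of_rowRel {R : Set (Crown n k × Crown n k)} {L : Crown n k → Crown n k → Prop}
    (hL : IsLinearOrder (Crown n k) L) (hle : ∀ x y, x ≤ y → L x y)
    (hrev : ∀ p ∈ R, L p.2 p.1 ∧ p.2 ≠ p.1) {x i : ZMod (n + k)} (h : RowRel R x i) :
    ¬ L (a i) (a x) := by
  obtain ⟨j, hj, hlt⟩ := h
  obtain ⟨h₁, h₂⟩ := hrev _ hj
  intro hix
  exact h₂ (hL.antisymm _ _ h₁ (hL.trans _ _ _ hix (hle _ _ hlt.le)))

theorem not_reversible_of_two_cycle {R : Set (Crown n k × Crown n k)} {x y : ZMod (n + k)}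
    (h₁ : RowRel R x y) (h₂ : RowRel R y x) : ¬ Reversible R := by
  rintro ⟨L, hL, hle, hrev⟩
  rcases hL.total (a x) (a y) with h | h
  · exact not_rel_of_rowRel hL hle hrev h₂ h
  · exact not_rel_of_rowRel hL hle hrev h₁ h

theorem not_reversible_of_three_cycle {R : Set (Crown n k × Crown n k)} {x y z : ZMod (n + k)}
    (h₁ : RowRel R x y) (h₂ : RowRel R y z) (h₃ : RowRel R z x) : ¬ Reversible R := by
  rintro ⟨L, hL, hle, hrev⟩
  have hxy := (hL.total (a x) (a y)).resolve_right (not_rel_of_rowRel hL hle hrev h₁)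
  have hyz := (hL.total (a y) (a z)).resolve_right (not_rel_of_rowRel hL hle hrev h₂)
  exact not_rel_of_rowRel hL hle hrev h₃ (hL.trans _ _ _ hxy hyz)

/-- Only `i` and `i'` can be targets of the row relation, so any cycle would contain a 2-cycle or a
loop, which the hypotheses exclude. -/
theorem reversible_pair {i j i' j' : ZMod (n + k)} (h : ¬ (a i : Crown n k) < b j)
    (h' : ¬ (a i' : Crown n k) < b j')
    (hcyc : ¬ ((a i : Crown n k) < b j' ∧ (a i' : Crown n k) < b j)) :
    Reversible {((a i, b j) : Crown n k × Crown n k), (a i', b j')} := by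
  have hrel : ∀ x y, RowRel {((a i, b j) : Crown n k × Crown n k), (a i', b j')} x y →
      (y = i ∧ (a x : Crown n k) < b j) ∨ (y = i' ∧ (a x : Crown n k) < b j') := by
    rintro x y ⟨l, hl, hlt⟩
    simp only [Set.mem_insert_iff, Set.mem_singleton_iff, Prod.mk.injEq, a.injEq, b.injEq] at hl
    rcases hl with ⟨rfl, rfl⟩ | ⟨rfl, rfl⟩
    · exact Or.inl ⟨rfl, hlt⟩
    · exact Or.inr ⟨rfl, hlt⟩
  have hasymm : ∀ x y, RowRel {((a i, b j) : Crown n k × Crown n k), (a i', b j')} x y →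
      ¬ RowRel {((a i, b j) : Crown n k × Crown n k), (a i', b j')} y x := by
    intro x y h₁ h₂
    rcases hrel _ _ h₁ with ⟨rfl, g₁⟩ | ⟨rfl, g₁⟩ <;> rcases hrel _ _ h₂ with ⟨rfl, g₂⟩ | ⟨rfl, g₂⟩
    · exact h g₂
    · exact hcyc ⟨g₂, g₁⟩
    · exact hcyc ⟨g₁, g₂⟩
    · exact h' g₂
  refine reversible_of_acyclic ?_ fun x hx => ?_
  · rintro p (rfl | rfl)
    · exact ⟨_, _, rfl⟩
    · exact ⟨_, _, rfl⟩
  · obtain ⟨u, v, w, x, huv, hvw, hwx, -, -, -⟩ := exists_chordless_path hasymm ⟨x, hx⟩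
    have hv : v = i ∨ v = i' := (hrel _ _ huv).imp And.left And.left
    have hw : w = i ∨ w = i' := (hrel _ _ hvw).imp And.left And.left
    have hx : x = i ∨ x = i' := (hrel _ _ hwx).imp And.left And.left
    have hvw' : v ≠ w := by rintro rfl; exact hasymm _ _ hvw hvw
    have hwx' : w ≠ x := by rintro rfl; exact hasymm _ _ hwx hwx
    have hvx : v = x := by
      rcases hv with hv | hv <;> rcases hw with hw | hw <;> rcases hx with hx | hx <;> simp_all
    subst hvx
    exact hasymm _ _ hvw hwx

/-- The relation between the rows of an independent set is asymmetric. -/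
theorem rowRel_asymm_of_isIndepSet (hn : 3 ≤ n) (hnk : n ≤ k) {S : Set (Crit (Crown n k))}
    (hS : (critGraph (Crown n k)).IsIndepSet S) (x y : ZMod (n + k))
    (hxy : RowRel (Subtype.val '' S) x y) : ¬ RowRel (Subtype.val '' S) y x := by
  intro hyx
  obtain ⟨j, ⟨p, hp, hpj⟩, hxj⟩ := hxy
  obtain ⟨l, ⟨q, hq, hql⟩, hyl⟩ := hyx
  have hnot : ∀ {p : Crit (Crown n k)} {i j}, p.1 = (a i, b j) → ¬ (a i : Crown n k) < b j := by
    intro p i j h hlt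
    have := p.2.1.1
    rw [h] at this
    exact this hlt.le
  have hpq : p ≠ q := by
    rintro rfl
    rw [hpj] at hql
    simp only [Prod.mk.injEq, a.injEq, b.injEq] at hql
    obtain ⟨rfl, rfl⟩ := hql
    exact hnot hpj hxj
  have hsing : ∀ r : Crit (Crown n k), CritReversible {r} := by
    intro r
    obtain ⟨i, j, hr, hij⟩ := exists_eq_of_mem_crit hn hnk r.2
    have := reversible_pair hij hij (fun h => hij h.1)
    rw [Set.pair_eq_singleton] at this
    unfold CritReversible
    rwa [Set.image_singleton, hr]
  refine hS hp hq hpq ⟨hpq, ?_, fun F hF => ?_⟩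
  · unfold CritReversible
    refine not_reversible_of_two_cycle (x := x) (y := y) ⟨j, ?_, hxj⟩ ⟨l, ?_, hyl⟩
    · exact ⟨p, by simp, hpj⟩
    · exact ⟨q, by simp, hql⟩
  · have hmono : ∀ r, F ⊆ {r} → CritReversible F := by
      intro r hr
      obtain ⟨L, hL, hle, hrev⟩ := hsing r
      exact ⟨L, hL, hle, fun p hp => hrev p (Set.image_mono hr hp)⟩
    by_cases hpF : p ∈ F
    · refine hmono p fun r hr => ?_
      rcases hF.1 hr with h | h
      · exact h
      · refine absurd ?_ hF.2
        rintro r' (rfl | rfl)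
        · exact hpF
        · rw [Set.mem_singleton_iff] at h
          exact h ▸ hr
    · refine hmono q fun r hr => ?_
      rcases hF.1 hr with h | h
      · exact absurd (h ▸ hr) hpF
      · exact h

end Crown

/-! ### Two counting inequalities -/

section Counting

open Finset
open scoped Pointwise

theorem card_add_le_card_add_Icc {n : ℕ} (hn : 2 ≤ n) {S : Finset ℕ} (hS : S.Nonempty) :
    #S + (n - 2) ≤ #(S + Icc 1 (n - 1)) := by
  have h := cauchy_davenport_add_of_linearOrder_isCancelAdd hS
    (nonempty_Icc.2 (by omega : 1 ≤ n - 1))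
  rw [Nat.card_Icc] at h
  have := hS.card_pos
  omega

/-- If `2 * |Q ∩ A|` is summed over the `i ∈ A` and each two `i, i' ∈ A` satisfy `i' ∈ Q i` or
`i ∈ Q i'`, the sum is at least `|A| ^ 2 + |A|`. -/
theorem card_mul_succ_le_two_mul_sum {α : Type*} [DecidableEq α] (A : Finset α)
    (Q : α → Finset α) (hself : ∀ i ∈ A, i ∈ Q i)
    (htot : ∀ i ∈ A, ∀ i' ∈ A, i' ∈ Q i ∨ i ∈ Q i') :
    #A * (#A + 1) ≤ 2 * ∑ i ∈ A, #(Q i ∩ A) := by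
  have h₁ : ∑ i ∈ A, #(Q i ∩ A) = ∑ i ∈ A, ∑ i' ∈ A, if i' ∈ Q i then 1 else 0 := by
    refine sum_congr rfl fun i _ => ?_
    rw [inter_comm, ← filter_mem_eq_inter, card_filter]
  have h₂ : ∑ i ∈ A, #(Q i ∩ A) = ∑ i ∈ A, ∑ i' ∈ A, if i ∈ Q i' then 1 else 0 := by
    rw [h₁, sum_comm]
  have h₃ : #A * (#A + 1) = ∑ i ∈ A, ∑ i' ∈ A, (1 + if i = i' then 1 else 0) := by
    have : ∀ i ∈ A, ∑ i' ∈ A, (1 + if i = i' then 1 else 0) = #A + 1 := by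
      intro i hi
      rw [sum_add_distrib, sum_ite_eq, if_pos hi]
      simp
    rw [sum_congr rfl this]
    simp
  rw [two_mul]
  nth_rewrite 1 [h₁]
  rw [h₂, ← sum_add_distrib, h₃]
  refine sum_le_sum fun i hi => ?_
  rw [← sum_add_distrib]
  refine sum_le_sum fun i' hi' => ?_
  by_cases hii : i = i'
  · subst hii
    simp [hself i hi]
  · rcases htot i hi i' hi' with h | h <;> simp [h, hii]

end Counting

/-! ### The upper bound for families of rows -/

namespace Crown

open Finset
open scoped Pointwise

variable {n k : ℕ}

/-- Cutting the circle at a point `x` such that no `a x < b j` with `j ∈ S` turns the cyclic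
intervals below the `b j` into intervals of integers. -/
theorem a_lt_b_iff_of_cut [NeZero (n + k)] (hn : 2 ≤ n) {x j : ZMod (n + k)}
    (hx : ¬ (a x : Crown n k) < b j) :
    (j - x).val + n ≤ n + k ∧ ∀ y, (a y : Crown n k) < b j ↔
      (j - x).val < (y - x).val ∧ (y - x).val < (j - x).val + n := by
  have htr : ∀ y, (a y : Crown n k) < b j ↔ (a (y - x) : Crown n k) < b (j - x) := by
    intro y
    rw [a_lt_b_iff_exists, a_lt_b_iff_exists]
    refine exists_congr fun t => and_congr_right fun _ => and_congr_right fun _ => ?_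
    rw [sub_add_eq_add_sub, sub_left_inj]
  have h := (j - x).val_lt
  rw [htr, a_lt_b_iff_val] at hx
  simp only [sub_self, ZMod.val_zero] at hx
  refine ⟨by omega, fun y => ?_⟩
  rw [htr, a_lt_b_iff_val]
  omega

/-- The points `x` for which no `a x < b j` with `j ∈ S`. -/
noncomputable def avoid [NeZero (n + k)] (S : Finset (ZMod (n + k))) : Finset (ZMod (n + k)) :=
  open Classical in univ.filter fun x => ∀ j ∈ S, ¬ (a x : Crown n k) < b j

theorem mem_avoid [NeZero (n + k)] {S : Finset (ZMod (n + k))} {x : ZMod (n + k)} :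
    x ∈ avoid S ↔ ∀ j ∈ S, ¬ (a x : Crown n k) < b j := by
  simp [avoid]

theorem val_sub_injective [NeZero (n + k)] (x : ZMod (n + k)) :
    Function.Injective fun y : ZMod (n + k) => (y - x).val := by
  intro y z h
  exact sub_left_injective (ZMod.val_injective _ h)

/-- After a cut at a point of `avoid S`, the sumset of `S` with `{1, …, n - 1}` does not wrap around
and is disjoint from `avoid S`; it has at least `#S + (n - 2)` elements. -/
theorem card_add_card_avoid_add_le [NeZero (n + k)] (hn : 2 ≤ n) {S : Finset (ZMod (n + k))}
    (hS : S.Nonempty) (hQ : (avoid S).Nonempty) : #S + #(avoid S) ≤ k + 2 := by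
  obtain ⟨x, hx⟩ := hQ
  have hcut := fun j hj => a_lt_b_iff_of_cut hn (mem_avoid.1 hx j hj)
  let φ : ZMod (n + k) → ℕ := fun y => (y - x).val
  have hφ : Function.Injective φ := val_sub_injective x
  have hsub : S.image φ + Icc 1 (n - 1) ⊆ range (n + k) \ (avoid S).image φ := by
    intro t ht
    obtain ⟨_, hs, c, hc, rfl⟩ := mem_add.1 ht
    obtain ⟨j, hj, rfl⟩ := mem_image.1 hs
    rw [mem_Icc] at hc
    have hj1 := (hcut j hj).1
    refine mem_sdiff.2 ⟨mem_range.2 (by simp only [φ]; omega), fun hmem => ?_⟩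
    obtain ⟨y, hy, hyt⟩ := mem_image.1 hmem
    refine mem_avoid.1 hy j hj (((hcut j hj).2 y).2 ?_)
    simp only [φ] at hyt
    omega
  have h₁ := card_le_card hsub
  have h₂ := card_add_le_card_add_Icc hn (hS.image φ)
  have h₃ : (avoid S).image φ ⊆ range (n + k) := by
    intro t ht
    obtain ⟨y, _, rfl⟩ := mem_image.1 ht
    exact mem_range.2 (ZMod.val_lt _)
  rw [card_sdiff_of_subset h₃, card_range, card_image_of_injective _ hφ] at h₁
  have h₄ := card_le_card h₃
  rw [card_range, card_image_of_injective _ hφ] at h₄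
  rw [card_image_of_injective _ hφ] at h₂
  omega

/-- If `avoid S` is not a cyclic interval, the bound on `|S| + |avoid S|` improves by `n - 2`. -/
theorem card_add_card_avoid_add_le_of_crossing [NeZero (n + k)] (hn : 2 ≤ n)
    {S : Finset (ZMod (n + k))} {x y p q : ZMod (n + k)} (hx : x ∈ avoid S) (hy : y ∈ avoid S)
    (hp : p ∉ avoid S) (hq : q ∉ avoid S) (hpy : (p - x).val < (y - x).val)
    (hyq : (y - x).val < (q - x).val) : #S + #(avoid S) + (n - 2) ≤ k + 2 := by
  have hcut := fun j hj => a_lt_b_iff_of_cut hn (mem_avoid.1 hx j hj)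
  let φ : ZMod (n + k) → ℕ := fun y => (y - x).val
  have hφ : Function.Injective φ := val_sub_injective x
  -- No arc meets `y`, so `S` splits into the parts before and after `y`, nonempty because of `p`
  -- and `q`. Their sumsets are disjoint, and each gains `n - 2`.
  let S₁ := S.filter fun j => φ j < φ y
  let S₂ := S.filter fun j => ¬ φ j < φ y
  have hside : ∀ j ∈ S, φ j < φ y → φ j + n ≤ φ y := by
    intro j hj h
    have := mem_avoid.1 hy j hj
    rw [(hcut j hj).2] at this
    simp only [φ] at h ⊢
    omega
  have hS₁ : S₁.Nonempty := by
    simp only [mem_avoid, not_forall, not_not] at hp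
    obtain ⟨j, hj, h⟩ := hp
    rw [(hcut j hj).2] at h
    exact ⟨j, mem_filter.2 ⟨hj, by simp only [φ]; omega⟩⟩
  have hS₂ : S₂.Nonempty := by
    simp only [mem_avoid, not_forall, not_not] at hq
    obtain ⟨j, hj, h⟩ := hq
    rw [(hcut j hj).2] at h
    refine ⟨j, mem_filter.2 ⟨hj, fun hlt => ?_⟩⟩
    have := hside j hj hlt
    simp only [φ] at this
    omega
  have hdisj : Disjoint (S₁.image φ + Icc 1 (n - 1)) (S₂.image φ + Icc 1 (n - 1)) := by
    rw [disjoint_left]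
    intro t ht₁ ht₂
    obtain ⟨_, hs, c, hc, rfl⟩ := mem_add.1 ht₁
    obtain ⟨j, hj, rfl⟩ := mem_image.1 hs
    obtain ⟨_, hs', d, hd, hcd⟩ := mem_add.1 ht₂
    obtain ⟨l, hl, rfl⟩ := mem_image.1 hs'
    obtain ⟨hj, hjy⟩ := mem_filter.1 hj
    obtain ⟨hl, hly⟩ := mem_filter.1 hl
    have := hside j hj hjy
    rw [mem_Icc] at hc hd
    omega
  have hsub : (S₁.image φ + Icc 1 (n - 1)) ∪ (S₂.image φ + Icc 1 (n - 1)) ⊆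
      range (n + k) \ (avoid S).image φ := by
    rw [← union_add, ← image_union, filter_union_filter_not_eq]
    intro t ht
    obtain ⟨_, hs, c, hc, rfl⟩ := mem_add.1 ht
    obtain ⟨j, hj, rfl⟩ := mem_image.1 hs
    rw [mem_Icc] at hc
    have hj1 := (hcut j hj).1
    refine mem_sdiff.2 ⟨mem_range.2 (by simp only [φ]; omega), fun hmem => ?_⟩
    obtain ⟨y, hy, hyt⟩ := mem_image.1 hmem
    refine mem_avoid.1 hy j hj (((hcut j hj).2 y).2 ?_)
    simp only [φ] at hyt
    omega
  have h₁ := card_le_card hsub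
  have h₂ := card_add_le_card_add_Icc hn (hS₁.image φ)
  have h₂' := card_add_le_card_add_Icc hn (hS₂.image φ)
  have h₃ : (avoid S).image φ ⊆ range (n + k) := by
    intro t ht
    obtain ⟨y, _, rfl⟩ := mem_image.1 ht
    exact mem_range.2 (ZMod.val_lt _)
  rw [card_union_of_disjoint hdisj, card_sdiff_of_subset h₃, card_range,
    card_image_of_injective _ hφ] at h₁
  have h₄ := card_le_card h₃
  rw [card_range, card_image_of_injective _ hφ] at h₄
  rw [card_image_of_injective _ hφ] at h₂ h₂'
  have h₅ : #S₁ + #S₂ = #S := card_filter_add_card_filter_not _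
  omega

/-- The crossing bound with the cut at a point outside `avoid S`. -/
theorem card_add_card_avoid_add_le_of_between [NeZero (n + k)] (hn : 2 ≤ n)
    {S : Finset (ZMod (n + k))} {x y p w : ZMod (n + k)} (hx : x ∈ avoid S) (hy : y ∈ avoid S)
    (hp : p ∉ avoid S) (hw : w ∉ avoid S) (hxp : (x - w).val < (p - w).val)
    (hpy : (p - w).val < (y - w).val) : #S + #(avoid S) + (n - 2) ≤ k + 2 := by
  have hsub : ∀ z, (x - w).val ≤ (z - w).val → (z - x).val = (z - w).val - (x - w).val := by
    intro z hz
    rw [← ZMod.val_sub hz, sub_sub_sub_cancel_right]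
  have hxw : x - w ≠ 0 := by
    rw [sub_ne_zero]
    rintro rfl
    exact hw hx
  have hwx : (w - x).val = n + k - (x - w).val := by
    have : NeZero (x - w) := ⟨hxw⟩
    rw [← neg_sub x w, ZMod.val_neg_of_ne_zero]
  have hylt := (y - w).val_lt
  -- The cyclic order `w, x, p, y` reads `x, p, y, w` from the cut at `x`.
  refine card_add_card_avoid_add_le_of_crossing hn hx hy hp hw ?_ ?_
  · rw [hsub p hxp.le, hsub y (hxp.trans hpy).le]
    omega
  · rw [hsub y (hxp.trans hpy).le, hwx]
    omega

/-- The row of `i` in a set of pairs `(i, j)`. -/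
def row [NeZero (n + k)] (T : Finset (ZMod (n + k) × ZMod (n + k))) (i : ZMod (n + k)) :
    Finset (ZMod (n + k)) :=
  univ.filter fun j => (i, j) ∈ T

theorem mem_row [NeZero (n + k)] {T : Finset (ZMod (n + k) × ZMod (n + k))}
    {i j : ZMod (n + k)} : j ∈ row T i ↔ (i, j) ∈ T := by
  simp [row]

/-- A set of index pairs whose row relation is asymmetric and has a cycle is small. -/
theorem two_mul_card_le_of_cycle [NeZero (n + k)] (hn : 2 ≤ n)
    (T : Finset (ZMod (n + k) × ZMod (n + k)))
    (hT : ∀ i j, (i, j) ∈ T → ¬ (a i : Crown n k) < b j)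
    (hasymm : ∀ x y, x ∉ avoid (row T y) → y ∈ avoid (row T x))
    (hcyc : ∃ x, Relation.TransGen (fun x y => x ∉ avoid (row T y)) x x) :
    2 * #T + 2 * (n - 2) ≤ (k + 1) * (k + 2) := by
  classical
  let A := univ.filter fun i => (row T i).Nonempty
  let Q := fun i => avoid (row T i)
  have hself : ∀ i, i ∈ Q i := fun i => mem_avoid.2 fun j hj => hT i j (mem_row.1 hj)
  have hcard : #T = ∑ i ∈ A, #(row T i) := by
    rw [card_eq_sum_card_fiberwise (f := Prod.fst) (t := A)]
    · refine sum_congr rfl fun i _ => ?_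
      refine card_bij (fun p _ => p.2) ?_ ?_ ?_
      · rintro ⟨i', j⟩ h
        obtain ⟨h', rfl⟩ := mem_filter.1 h
        exact mem_row.2 h'
      · rintro ⟨i₁, j₁⟩ h₁ ⟨i₂, j₂⟩ h₂ h
        obtain ⟨-, rfl⟩ := mem_filter.1 h₁
        obtain ⟨-, rfl⟩ := mem_filter.1 h₂
        simpa using h
      · intro j hj
        exact ⟨(i, j), mem_filter.2 ⟨mem_row.1 hj, rfl⟩, rfl⟩
    · rintro ⟨i, j⟩ h
      exact mem_coe.2 (mem_filter.2 ⟨mem_univ _, j, mem_row.2 h⟩)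
  have hrow : ∀ i ∈ A, #(row T i) + #(Q i) ≤ k + 2 := fun i hi =>
    card_add_card_avoid_add_le hn (mem_filter.1 hi).2 ⟨i, hself i⟩
  have hQA := card_mul_succ_le_two_mul_sum A Q (fun i _ => hself i) fun i _ i' _ => by
    by_contra! h
    exact h.2 (hasymm _ _ h.1)
  have hsplit : ∑ i ∈ A, #(Q i) = ∑ i ∈ A, #(Q i ∩ A) + ∑ i ∈ A, #(Q i \ A) := by
    rw [← sum_add_distrib]
    exact sum_congr rfl fun i _ => (card_inter_add_card_sdiff _ _).symm
  by_cases hcross : ∃ i ∈ A, #(row T i) + #(Q i) + (n - 2) ≤ k + 2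
  · obtain ⟨i, hi, hcross⟩ := hcross
    have hsum : ∑ i ∈ A, #(row T i) + ∑ i ∈ A, #(Q i) + (n - 2) ≤ #A * (k + 2) := by
      rw [← sum_add_distrib, ← add_sum_erase _ _ hi]
      have h₁ : ∑ i ∈ A.erase i, (#(row T i) + #(Q i)) ≤ #(A.erase i) * (k + 2) :=
        sum_le_card_nsmul _ _ _ fun j hj => hrow j (mem_of_mem_erase hj)
      rw [← card_erase_add_one hi, add_mul]
      omega
    rw [← hcard] at hsum
    generalize #A = s at *
    zify at *
    generalize ((n - 2 : ℕ) : ℤ) = d at *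
    have hsq : 0 ≤ ((k : ℤ) + 2 - s) * ((k : ℤ) + 2 - s - 1) := by
      rcases le_or_gt ((k : ℤ) + 2 - s) 0 with h | h
      · exact mul_nonneg_of_nonpos_of_nonpos h (by omega)
      · exact mul_nonneg h.le (by omega)
    have h0 : (0 : ℤ) ≤ ∑ i ∈ A, (#(Q i \ A) : ℤ) := sum_nonneg fun _ _ => by positivity
    nlinarith
  · push Not at hcross
    obtain ⟨u, v, w, x, huv, hvw, hwx, huw, hvx, hux⟩ :=
      exists_chordless_path (fun x y h h' => h' (hasymm x y h)) hcyc
    simp only [not_not] at huw hvx hux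
    have hA : ∀ {x i}, x ∉ Q i → i ∈ A := by
      intro x i h
      simp only [Q, mem_avoid, not_forall] at h
      obtain ⟨j, hj, -⟩ := h
      exact mem_filter.2 ⟨mem_univ _, j, hj⟩
    have hcover : ∀ z, z ∈ Q v ∨ z ∈ Q w ∨ z ∈ Q x := by
      intro z
      by_contra! hz
      obtain ⟨hzv, hzw, hzx⟩ := hz
      have hbet : ∀ i c p d, p ∉ Q i → z ∉ Q i → c ∈ Q i → d ∈ Q i →
          ¬ ((c - z).val < (p - z).val ∧ (p - z).val < (d - z).val) := by
        intro i c p d hp hz hc hd h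
        have h₁ := card_add_card_avoid_add_le_of_between hn hc hd hp hz h.1 h.2
        have h₂ := hcross i (hA hp)
        simp only [Q] at h₂
        omega
      have hinj : ∀ {c d}, c ≠ d → (c - z).val ≠ (d - z).val := fun hcd h =>
        hcd (val_sub_injective z h)
      have huv' := hinj (show u ≠ v by rintro rfl; exact huv (hself _))
      have hvw' := hinj (show v ≠ w by rintro rfl; exact hvw (hself _))
      have huw' := hinj (show u ≠ w by rintro rfl; exact huv (hasymm _ _ hvw))
      -- Cut at `z`, no point outside one of these sets lies between two of its points. But `Q v`
      -- contains `v, w` and not `u`, `Q w` contains `u, w` and not `v`, and `Q x` contains `u, v`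
      -- and not `w`: none of `u, v, w` could be the middle one.
      have b₁ := hbet v v u w huv hzv (hself _) (hasymm _ _ hvw)
      have b₂ := hbet v w u v huv hzv (hasymm _ _ hvw) (hself _)
      have b₃ := hbet w u v w hvw hzw huw (hself _)
      have b₄ := hbet w w v u hvw hzw (hself _) huw
      have b₅ := hbet x u w v hwx hzx hux hvx
      have b₆ := hbet x v w u hwx hzx hvx hux
      omega
    have hmiss : #(univ \ A) ≤ ∑ i ∈ A, #(Q i \ A) := by
      refine (card_le_card ?_).trans card_biUnion_le
      intro z hz
      have hzA := (mem_sdiff.1 hz).2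
      rw [mem_biUnion]
      rcases hcover z with h | h | h
      · exact ⟨v, hA huv, mem_sdiff.2 ⟨h, hzA⟩⟩
      · exact ⟨w, hA hvw, mem_sdiff.2 ⟨h, hzA⟩⟩
      · exact ⟨x, hA hwx, mem_sdiff.2 ⟨h, hzA⟩⟩
    have hcompl : #(univ \ A) + #A = n + k := by
      rw [card_sdiff_add_card_eq_card (subset_univ _), card_univ, ZMod.card]
    have hsum : ∑ i ∈ A, #(row T i) + ∑ i ∈ A, #(Q i) ≤ #A * (k + 2) := by
      rw [← sum_add_distrib]
      exact sum_le_card_nsmul _ _ _ hrow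
    rw [← hcard] at hsum
    obtain ⟨d, rfl⟩ : ∃ d, n = d + 2 := ⟨n - 2, by omega⟩
    rw [Nat.add_sub_cancel]
    generalize ∑ i ∈ A, #(Q i \ A) = e at *
    generalize ∑ i ∈ A, #(Q i ∩ A) = f at *
    generalize ∑ i ∈ A, #(Q i) = g at *
    generalize #(univ \ A) = c at *
    generalize #A = s at *
    clear hcross
    zify at *
    have hsq : 0 ≤ ((k : ℤ) + 2 - s) * ((k : ℤ) + 2 - s + 1) := by
      rcases le_or_gt 0 ((k : ℤ) + 2 - s) with h | h
      · exact mul_nonneg h (by omega)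
      · exact mul_nonneg_of_nonpos_of_nonpos h.le (by omega)
    nlinarith

end Crown

/-! ### The bound for critical pairs and its sharpness -/

namespace Crown

open Finset

variable {n k : ℕ}

theorem two_mul_card_le (hn : 3 ≤ n) (hnk : n ≤ k) (S : Finset (Crit (Crown n k)))
    (hind : (critGraph (Crown n k)).IsIndepSet (S : Set (Crit (Crown n k))))
    (hrev : ¬ CritReversible (S : Set (Crit (Crown n k)))) :
    2 * #S + 2 * (n - 2) ≤ (k + 1) * (k + 2) := by
  classical
  have : NeZero (n + k) := ⟨by omega⟩
  choose i j hp hlt using fun p : Crit (Crown n k) => exists_eq_of_mem_crit hn hnk p.2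
  let T : Finset (ZMod (n + k) × ZMod (n + k)) := S.image fun p => (i p, j p)
  have hinj : Function.Injective fun p => (i p, j p) := by
    intro p q h
    simp only [Prod.mk.injEq] at h
    exact Subtype.ext (by rw [hp p, hp q, h.1, h.2])
  have hmem : ∀ x y, (x, y) ∈ T ↔ (a x, b y) ∈ Subtype.val '' (S : Set (Crit (Crown n k))) := by
    intro x y
    simp only [T, mem_image, Set.mem_image, mem_coe]
    refine exists_congr fun p => and_congr_right fun _ => ?_
    rw [hp p]
    simp
  have hrel : (fun x y => x ∉ avoid (row T y)) =
      RowRel (Subtype.val '' (S : Set (Crit (Crown n k)))) := by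
    funext x y
    simp only [mem_avoid, mem_row, not_forall, not_not, exists_prop, hmem, RowRel]
  have hasymm := rowRel_asymm_of_isIndepSet hn hnk hind
  rw [← hrel] at hasymm
  rw [← card_image_of_injective S hinj]
  refine two_mul_card_le_of_cycle (by omega) T ?_ (fun x y h => not_not.1 (hasymm x y h)) ?_
  · intro x y hxy
    obtain ⟨p, -, h⟩ := mem_image.1 hxy
    simp only [Prod.mk.injEq] at h
    rw [← h.1, ← h.2]
    exact hlt p
  · rw [hrel]
    by_contra! h
    refine hrev (reversible_of_acyclic ?_ h)
    rintro _ ⟨p, -, rfl⟩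
    exact ⟨_, _, hp p⟩

/-- The rows of a largest independent set that is not reversible. -/
def extremalRow (n k i : ℕ) : Finset ℕ :=
  if i = 0 then Icc (n - 1) k else if i < n then Icc n (k + i) else
    if i = n then insert 0 (Icc n k) else Icc i k

theorem two_mul_sum_card_extremalRow (hn : 3 ≤ n) (hnk : n ≤ k) :
    2 * ∑ i ∈ range (k + 1), #(extremalRow n k i) + 2 * (n - 2) = (k + 1) * (k + 2) := by
  obtain ⟨d, rfl⟩ : ∃ d, k = n + d := ⟨k - n, by omega⟩
  obtain ⟨c, rfl⟩ : ∃ c, n = c + 2 := ⟨n - 2, by omega⟩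
  have hmid : ∀ e ≤ c + 1, 2 * ∑ i ∈ range e, #(extremalRow (c + 2) (c + 2 + d) (i + 1)) =
      e * (2 * d + e + 3) := by
    intro e he
    induction e with
    | zero => simp
    | succ e ih =>
      rw [sum_range_succ, mul_add, ih (by omega), extremalRow, if_neg (by omega),
        if_pos (by omega), Nat.card_Icc,
        show c + 2 + d + (e + 1) + 1 - (c + 2) = d + e + 2 by omega]
      ring
  have hlast : ∀ e ≤ d, 2 * ∑ i ∈ range e,
      #(extremalRow (c + 2) (c + 2 + d) (c + 2 + (d - e) + 1 + i)) = e * (e + 1) := by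
    intro e he
    induction e with
    | zero => simp
    | succ e ih =>
      rw [sum_range_succ', mul_add]
      have : ∀ i, c + 2 + (d - (e + 1)) + 1 + (i + 1) = c + 2 + (d - e) + 1 + i := by
        intro i
        omega
      simp only [this]
      rw [ih (by omega), extremalRow, if_neg (by omega), if_neg (by omega), if_neg (by omega),
        Nat.card_Icc,
        show c + 2 + d + 1 - (c + 2 + (d - (e + 1)) + 1 + 0) = e + 1 by omega]
      ring
  have h0 : #(extremalRow (c + 2) (c + 2 + d) 0) = d + 2 := by
    rw [extremalRow, if_pos rfl, Nat.card_Icc]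
    omega
  have hn' : #(extremalRow (c + 2) (c + 2 + d) (c + 2)) = d + 2 := by
    rw [extremalRow, if_neg (by omega), if_neg (by omega), if_pos rfl,
      card_insert_of_notMem (by simp), Nat.card_Icc]
    omega
  have h₁ := hmid (c + 1) le_rfl
  have h₂ := hlast d le_rfl
  rw [Nat.sub_self, add_zero] at h₂
  rw [show c + 2 + d + 1 = (c + 2 + 1) + d by ring, sum_range_add, sum_range_succ, sum_range_succ',
    h0, hn', Nat.add_sub_cancel]
  rw [mul_add, mul_add, mul_add, h₁, h₂]
  ring

theorem exists_indep_not_reversible (hn : 3 ≤ n) (hnk : n ≤ k) :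
    ∃ S : Finset (Crit (Crown n k)),
      (critGraph (Crown n k)).IsIndepSet (S : Set (Crit (Crown n k))) ∧
      ¬ CritReversible (S : Set (Crit (Crown n k))) ∧
      2 * #S + 2 * (n - 2) = (k + 1) * (k + 2) := by
  classical
  have : NeZero (n + k) := ⟨by omega⟩
  have hval : ∀ w, w < n + k → ((w : ZMod (n + k))).val = w := fun w hw => ZMod.val_cast_of_lt hw
  let I := (range (k + 1)).sigma (extremalRow n k)
  have hI : ∀ s ∈ I, s.1 < n + k ∧ s.2 < n + k ∧ ((s.1 = 0 ∧ n - 1 ≤ s.2 ∧ s.2 ≤ k) ∨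
      (0 < s.1 ∧ s.1 < n ∧ n ≤ s.2 ∧ s.2 ≤ k + s.1) ∨ (s.1 = n ∧ s.2 = 0) ∨
      (n ≤ s.1 ∧ s.1 ≤ s.2 ∧ s.2 ≤ k)) := by
    rintro ⟨i, j⟩ h
    obtain ⟨hi, hj⟩ := mem_sigma.1 h
    simp only [extremalRow, mem_range] at hi hj ⊢
    split_ifs at hj <;> simp only [mem_insert, mem_Icc] at hj <;> omega
  have hcrit : ∀ s ∈ I, ¬ (a (s.1 : ZMod (n + k)) : Crown n k) < b (s.2 : ZMod (n + k)) := by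
    intro s hs
    have h := hI s hs
    rw [a_lt_b_iff_val, hval _ h.1, hval _ h.2.1]
    omega
  let f : I → Crit (Crown n k) := fun s => ⟨(a (s.1.1 : ZMod (n + k)), b (s.1.2 : ZMod (n + k))),
    mem_crit_of_not_lt (hcrit s.1 s.2)⟩
  have hf : Function.Injective f := by
    rintro ⟨⟨i, j⟩, hs⟩ ⟨⟨i', j'⟩, hs'⟩ h
    have h := congrArg Subtype.val h
    simp only [f, Prod.mk.injEq, a.injEq, b.injEq] at h
    have h₁ := congrArg ZMod.val h.1
    have h₂ := congrArg ZMod.val h.2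
    rw [hval _ (hI _ hs).1, hval _ (hI _ hs').1] at h₁
    rw [hval _ (hI _ hs).2.1, hval _ (hI _ hs').2.1] at h₂
    subst h₁ h₂
    rfl
  refine ⟨univ.image f, ?_, ?_, ?_⟩
  · intro p hp q hq hpq hadj
    obtain ⟨s, -, rfl⟩ := mem_image.1 (mem_coe.1 hp)
    obtain ⟨t, -, rfl⟩ := mem_image.1 (mem_coe.1 hq)
    refine hadj.2.1 ?_
    unfold CritReversible
    rw [Set.image_pair]
    refine reversible_pair (hcrit _ s.2) (hcrit _ t.2) ?_
    have hs := hI _ s.2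
    have ht := hI _ t.2
    rw [a_lt_b_iff_val, a_lt_b_iff_val, hval _ hs.1, hval _ hs.2.1, hval _ ht.1, hval _ ht.2.1]
    omega
  · have hrel : ∀ x i j, x < n + k → j < n + k → i < k + 1 → j ∈ extremalRow n k i →
        ((j < x ∧ x < j + n) ∨ x + k < j) →
        RowRel (Subtype.val '' ((univ.image f : Finset _) : Set (Crit (Crown n k))))
          (x : ZMod (n + k)) (i : ZMod (n + k)) := by
      intro x i j hx hj hi hij hlt
      refine ⟨j, ⟨f ⟨⟨i, j⟩, mem_sigma.2 ⟨mem_range.2 hi, hij⟩⟩, ?_, rfl⟩, ?_⟩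
      · exact mem_coe.2 (mem_image_of_mem _ (mem_univ _))
      · rwa [a_lt_b_iff_val, hval x hx, hval j hj]
    -- The cycle 0 → 1 → n → 0 comes from the pairs with indices `(1, k + 1)`, `(n, 0)` and `(0, n -
    -- 1)`.
    refine not_reversible_of_three_cycle (hrel 0 1 (k + 1) ?_ ?_ ?_ ?_ ?_)
      (hrel 1 n 0 ?_ ?_ ?_ ?_ ?_) (hrel n 0 (n - 1) ?_ ?_ ?_ ?_ ?_)
    all_goals first
      | omega
      | (unfold extremalRow; split_ifs <;> simp <;> omega)
  · rw [card_image_of_injective _ hf, card_univ, Fintype.card_coe, card_sigma]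
    exact two_mul_sum_card_extremalRow hn hnk

end Crown

theorem theorem1p5 (n k : ℕ) (hn : 3 ≤ n) (hnk : n ≤ k) :
    (∀ S : Finset (Crit (Crown n k)),
      (critGraph (Crown n k)).IsIndepSet (S : Set (Crit (Crown n k))) →
      ¬ CritReversible (S : Set (Crit (Crown n k))) →
      (S.card : ℚ) ≤ ((k : ℚ) + 1) * ((k : ℚ) + 2) / 2 + 2 - (n : ℚ)) ∧
    (∃ S : Finset (Crit (Crown n k)),
      (critGraph (Crown n k)).IsIndepSet (S : Set (Crit (Crown n k))) ∧
      ¬ CritReversible (S : Set (Crit (Crown n k))) ∧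
      (S.card : ℚ) = ((k : ℚ) + 1) * ((k : ℚ) + 2) / 2 + 2 - (n : ℚ)) := by
  have hcast : ((n - 2 : ℕ) : ℚ) = n - 2 := by
    rw [Nat.cast_sub (by omega)]
    norm_num
  constructor
  · intro S hind hrev
    have h : ((2 * S.card + 2 * (n - 2) : ℕ) : ℚ) ≤ ((k + 1) * (k + 2) : ℕ) := by
      exact_mod_cast Crown.two_mul_card_le hn hnk S hind hrev
    push_cast [hcast] at h
    linarith
  · obtain ⟨S, hind, hrev, hcard⟩ := Crown.exists_indep_not_reversible hn hnk
    refine ⟨S, hind, hrev, ?_⟩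
    have h : ((2 * S.card + 2 * (n - 2) : ℕ) : ℚ) = ((k + 1) * (k + 2) : ℕ) := by
      rw [hcard]
    push_cast [hcast] at h
    linarith
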